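/- **The game.** Let $G=(V,E)$ be a finite, simple, connected, undirected graph, with closed neighbourhoods $N[x]$. The tokens $C_1,C_2$ (two cops) and $R$ (the robber) occupy vertices of $G$. The states are the quadruples $s=(x^1,x^2,x^3,u)\in V\times V\times V\times\{1,2\}$ (locations of $C_1,C_2,R$, and the cop $u$ who moves next) and a terminal state $\tau$; write $\mathbf S_u=V\times V\times V\times\{u\}$ and $\mathbf S=\mathbf S_1\cup\mathbf S_2\cup\{\tau\}$. A state is a $C_1$-capture state if $x^1=x^3$, and a $C_2$-capture state if $x^2=x^3\neq x^1$. Put $q(s)=1$ if $s$ is a $C_1$-capture state and $q(s)=0$ otherwise; in particular $q(\tau)=0$. Capture states and $\tau$ always pass to $\tau$. From any other state $(x^1,x^2,x^3,1)$, $C_1$ chooses $a^1\in N[x^1]$ and the next state is $(a^1,x^2,x^3,2)$. From any other state $(x^1,x^2,x^3,2)$, first $C_2$ chooses $a^2\in N[x^2]$; if $a^2=x^3$, the robber is caught and the next state is $(x^1,x^3,x^3,1)$; otherwise the robber moves to a random $a^3\in N[x^3]$ and the next state is $(x^1,a^2,a^3,1)$. The law $\sigma_3(\cdot\mid s)$ of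 the robber's move is fixed, is known to both cops and depends only on the current state $s$ (before the move of $C_2$). Let $\Pr(s'\mid s,a^1,a^2)$ be the resulting transition probabilities. A strategy $\sigma_i$ of cop $i$ assigns to every finite history $s_0s_1\dots s_t$ of states a probability distribution on his legal moves in $s_t$ (a cop who is not on turn stays where he is; in $\tau$ only a null move is available). Given the history, the moves are drawn independently. With $\mathbb E$ the expectation under the law on infinite histories induced by $\sigma_1,\sigma_2,\sigma_3$ and the starting state $s_0$, let $$J(\sigma_1,\sigma_2\mid s_0)=\mathbb E\Big(\sum_{t=0}^\infty q(s_t)\Big).$$ The value $v(s)$ of the game started at $s$ is the common value of $\sup_{\sigma_1}\inf_{\sigma_2}J(\sigma_1,\sigma_2\mid s)$ and $\inf_{\sigma_2}\sup_{\sigma_1}J(\sigma_1,\sigma_2\mid s)$, if these are equal. **Theorem.** Define $v^{(0)}(\tau)=0$ and $v^{(0)}(s)=q(s)$ for $s\in\mathbf S_1\cup\mathbf S_2$ and, for $i\ge 1$, $v^{(i)}(\tau)=0$, $$v^{(i)}(s)=\max_{a^1\in N[x^1]}\Big[q(s)+\sum_{s'\in\mathbf S}\Pr(s'\mid s,a^1,x^2)\,v^{(i-1)}(s')\Big]\quad\text{for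 } s=(x^1,x^2,x^3,1)\in\mathbf S_1,$$ $$v^{(i)}(s)=\min_{a^2\in N[x^2]}\Big[q(s)+\sum_{s'\in\mathbf S}\Pr(s'\mid s,x^1,a^2)\,v^{(i-1)}(s')\Big]\quad\text{for } s=(x^1,x^2,x^3,2)\in\mathbf S_2.$$ Then, for every $s\in\mathbf S_1\cup\mathbf S_2$, the game started at $s$ has a finite value $v(s)$, and $\lim_{i\to\infty}v^{(i)}(s)$ exists and equals $v(s)$. -/

import Mathlib

open MeasureTheory ProbabilityTheory Filter Topology
open scoped ENNReal NNReal

noncomputable section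

namespace SCPR

/-- The two cop players. -/
inductive Cop
  | C₁
  | C₂

/-- The three tokens: the two cop tokens and the robber token. -/
inductive Token
  | C₁
  | C₂
  | R

/-- A game state: either `(x₁, x₂, x₃, u)`, where `x₁`, `x₂`, `x₃` are the locations of the tokens
`C₁`, `C₂`, `R` and `u` is the cop who moves in the next turn, or the terminal state `τ`. -/
inductive State (V : Type*)
  | pos (x₁ x₂ x₃ : V) (u : Cop)
  | terminal

variable {V : Type*}

instance : Finite Cop :=
  Finite.of_injective (fun u : Cop => match u with | .C₁ => true | .C₂ => false)
    (by intro a b; cases a <;> cases b <;> simp)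

instance [Finite V] : Finite (State V) :=
  Finite.of_injective
    (fun s : State V => match s with
      | .pos x₁ x₂ x₃ u => some (x₁, x₂, x₃, u)
      | .terminal => none)
    (by intro a b; cases a <;> cases b <;> simp)

/-- Every set of states is measurable. -/
instance : MeasurableSpace (State V) := ⊤

instance : DiscreteMeasurableSpace (State V) := ⟨fun _ => trivial⟩

/-- A `C₁`-capture state: `x₁ = x₃`. -/
def IsCapture₁ : State V → Prop
  | .pos x₁ _ x₃ _ => x₁ = x₃
  | .terminal => False

/-- A `C₂`-capture state: `x₂ = x₃` and `x₁ ≠ x₃`. -/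
def IsCapture₂ : State V → Prop
  | .pos x₁ x₂ x₃ _ => x₂ = x₃ ∧ x₁ ≠ x₃
  | .terminal => False

/-- A capture state of either cop. -/
def IsCapture (s : State V) : Prop := IsCapture₁ s ∨ IsCapture₂ s

/-- The closed neighbourhood `N[x]`. -/
def closedNbhd (G : SimpleGraph V) (x : V) : Set V := {y | y = x ∨ G.Adj x y}

/-- A move is either a vertex or the null move `λ`, which is represented by `none`. -/
abbrev Move (V : Type*) := Option V

/-- The set of moves available to a token in a state. When it is the turn of `C₁`, only the token
`C₁` moves; when it is the turn of `C₂`, the tokens `C₂` and `R` move. A token that does not move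
stays where it is. In the terminal state only the null move is available. -/
def legalMoves (G : SimpleGraph V) : Token → State V → Set (Move V)
  | .C₁, .pos x₁ _ _ .C₁ => some '' closedNbhd G x₁
  | .C₂, .pos _ x₂ _ .C₁ => {some x₂}
  | .R,  .pos _ _ x₃ .C₁ => {some x₃}
  | .C₁, .pos x₁ _ _ .C₂ => {some x₁}
  | .C₂, .pos _ x₂ _ .C₂ => some '' closedNbhd G x₂
  | .R,  .pos _ _ x₃ .C₂ => some '' closedNbhd G x₃
  | _, .terminal => {none}

open Classical in
/-- The next state, when in state `s` the tokens `C₁`, `C₂`, `R` play `a₁`, `a₂`, `a₃`.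
A capture state and the terminal state always lead to the terminal state. In a turn of `C₂`, first
`C₂` moves and then `R`; if `C₂` reaches the vertex `x₃` occupied by the robber, then
the robber is captured there, irrespective of the robber's move.
(The null move is not legal outside the terminal state; it is read there as staying.) -/
def next (s : State V) (a₁ a₂ a₃ : Move V) : State V :=
  match s with
  | .terminal => .terminal
  | .pos x₁ x₂ x₃ u =>
    if IsCapture (.pos x₁ x₂ x₃ u) then .terminal
    else match u with
      | .C₁ => .pos (a₁.getD x₁) (a₂.getD x₂) (a₃.getD x₃) .C₂
      | .C₂ => .pos (a₁.getD x₁) (a₂.getD x₂)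
          (if a₂.getD x₂ = x₃ then x₃ else a₃.getD x₃) .C₁

/-- A finite history `s₀ s₁ … s_t`. -/
abbrev History (V : Type*) (t : ℕ) := Finset.Iic t → State V

/-- The current (last) state of a finite history. -/
def History.last {t : ℕ} (h : History V t) : State V := h ⟨t, Finset.mem_Iic.2 le_rfl⟩

/-- A strategy for the `i`-th token: a probability distribution of the next move for every finite
history, assigning zero probability to illegal moves. -/
structure Strategy (G : SimpleGraph V) (i : Token) where
  /-- `prob t (s₀ … s_t) a` is the probability `σ(a | s₀ … s_t)`. -/
  prob : (t : ℕ) → History V t → PMF (Move V)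
  legal : ∀ (t : ℕ) (h : History V t) (a : Move V), a ∉ legalMoves G i h.last → prob t h a = 0

/-- A strategy is stationary Markovian if the law of the next move depends only on the current
state. -/
def Strategy.IsStationaryMarkovian {G : SimpleGraph V} {i : Token} (σ : Strategy G i) : Prop :=
  ∀ (t t' : ℕ) (h : History V t) (h' : History V t'), h.last = h'.last → σ.prob t h = σ.prob t' h'

variable {G : SimpleGraph V}

/-- The conditional law of the state `s_{t+1}` given `s₀ … s_t`, when the tokens are
moved (independently, given the history) by `σ₁`, `σ₂`, `σ₃`. -/
def stepLaw (σ₁ : Strategy G .C₁) (σ₂ : Strategy G .C₂) (σ₃ : Strategy G .R)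
    (t : ℕ) (h : History V t) : PMF (State V) :=
  (σ₁.prob t h).bind fun a₁ => (σ₂.prob t h).bind fun a₂ => (σ₃.prob t h).map fun a₃ =>
    next h.last a₁ a₂ a₃

/-- `stepLaw` as a Markov kernel. -/
def stepKernel [Finite V] (σ₁ : Strategy G .C₁) (σ₂ : Strategy G .C₂) (σ₃ : Strategy G .R)
    (t : ℕ) : Kernel (History V t) (State V) where
  toFun h := (stepLaw σ₁ σ₂ σ₃ t h).toMeasure
  measurable' := .of_discrete

instance [Finite V] (σ₁ : Strategy G .C₁) (σ₂ : Strategy G .C₂) (σ₃ : Strategy G .R) (t : ℕ) :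
    IsMarkovKernel (stepKernel σ₁ σ₂ σ₃ t) :=
  ⟨fun h => PMF.toMeasure.isProbabilityMeasure (stepLaw σ₁ σ₂ σ₃ t h)⟩

/-- The probability measure on the set of infinite histories `s₀ s₁ s₂ …` that is induced by
`(σ₁, σ₂, σ₃)` and the starting state `s₀` (Ionescu-Tulcea). -/
def playMeasure [Finite V] (σ₁ : Strategy G .C₁) (σ₂ : Strategy G .C₂) (σ₃ : Strategy G .R)
    (s₀ : State V) : Measure (ℕ → State V) :=
  Kernel.traj (X := fun _ => State V) (stepKernel σ₁ σ₂ σ₃) 0 (fun _ => s₀)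

open Classical in
/-- The immediate payoff: `1` in `C₁`-capture states and `0` otherwise. -/
def q (s : State V) : ℝ≥0∞ := if IsCapture₁ s then 1 else 0

/-- The expected total payoff `J(σ₁, σ₂ | s₀) = 𝔼 (∑ₜ q(s_t))` to `C₁`. -/
def J [Finite V] (σ₃ : Strategy G .R) (σ₁ : Strategy G .C₁) (σ₂ : Strategy G .C₂)
    (s₀ : State V) : ℝ≥0∞ :=
  ∫⁻ ω, ∑' t, q (ω t) ∂(playMeasure σ₁ σ₂ σ₃ s₀)

/-- `v` is the value of the sequential game started at `s₀`: it equals both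
`sup_{σ₁} inf_{σ₂} J(σ₁, σ₂ | s₀)` and `inf_{σ₂} sup_{σ₁} J(σ₁, σ₂ | s₀)`. -/
def IsValue [Finite V] (σ₃ : Strategy G .R) (s₀ : State V) (v : ℝ≥0∞) : Prop :=
  (⨆ σ₁ : Strategy G .C₁, ⨅ σ₂ : Strategy G .C₂, J σ₃ σ₁ σ₂ s₀) = v ∧
  (⨅ σ₂ : Strategy G .C₂, ⨆ σ₁ : Strategy G .C₁, J σ₃ σ₁ σ₂ s₀) = v

/-- The transition law `Pr(· | s, a₁, a₂)`, when the robber's move is drawn from `σ₃(· | s)`. -/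
def transLaw (σ₃ : Strategy G .R) (s : State V) (a₁ a₂ : Move V) : PMF (State V) :=
  (σ₃.prob 0 (fun _ => s)).map fun a₃ => next s a₁ a₂ a₃

/-- The quantity `q(s) + ∑_{s'} Pr(s' | s, a₁, a₂) w(s')`. -/
def lookahead (σ₃ : Strategy G .R) (w : State V → ℝ≥0∞) (s : State V) (a₁ a₂ : Move V) : ℝ≥0∞ :=
  q s + ∑' s', transLaw σ₃ s a₁ a₂ s' * w s'

/-- Value iteration: the sequence `v⁽⁰⁾, v⁽¹⁾, v⁽²⁾, …`. The supremum and the infimum are over a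
nonempty set of moves, which is finite when `V` is, so they are a maximum and a minimum. -/
def valueIter (σ₃ : Strategy G .R) : ℕ → State V → ℝ≥0∞
  | _, .terminal => 0
  | 0, s => q s
  | i + 1, .pos x₁ x₂ x₃ .C₁ =>
      ⨆ a₁ ∈ legalMoves G .C₁ (.pos x₁ x₂ x₃ .C₁),
        lookahead σ₃ (valueIter σ₃ i) (.pos x₁ x₂ x₃ .C₁) a₁ (some x₂)
  | i + 1, .pos x₁ x₂ x₃ .C₂ =>
      ⨅ a₂ ∈ legalMoves G .C₂ (.pos x₁ x₂ x₃ .C₂),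
        lookahead σ₃ (valueIter σ₃ i) (.pos x₁ x₂ x₃ .C₂) (some x₁) a₂

end SCPR

end

namespace SCPR

variable {V : Type*} {G : SimpleGraph V}

/-! ### Averages with respect to a probability mass function -/

/-! In every state at most one cop has a real choice, so the one-step operator `gameOp` has no gap
between sup-inf and inf-sup. Its iterates increase from `q` and stay at most 1, since a payoff is
followed at once by the terminal state. Their supremum `valueLim` is a fixed point because only
finitely many moves compete (`gameOp_valueLim`). For `C₁`, optimal play for a fixed horizon `n`
secures the `n`-th iterate: payoffs after the horizon are nonnegative and can be dropped
(`exists_valueIter_le_J`). A move optimal for the limit itself would not do, as it may postpone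
capture forever; the supremum over `n` suffices. For `C₂`, a minimizing move for the fixed point
makes the accumulated payoff plus `valueLim` of the current state a supermartingale, which bounds
the total payoff (`exists_J_le_valueLim`). -/

lemma tsum_bind_mul {α β : Type*} (p : PMF α) (k : α → PMF β) (f : β → ℝ≥0∞) :
    ∑' b, p.bind k b * f b = ∑' a, p a * ∑' b, k a b * f b := by
  simp_rw [PMF.bind_apply, ← ENNReal.tsum_mul_right, ← ENNReal.tsum_mul_left, ← mul_assoc]
  exact ENNReal.tsum_comm

lemma tsum_pmf_mul_const {α : Type*} (p : PMF α) (c : ℝ≥0∞) : ∑' a, p a * c = c := by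
  rw [ENNReal.tsum_mul_right, p.tsum_coe, one_mul]

lemma tsum_pmf_mul_le {α : Type*} (p : PMF α) {f : α → ℝ≥0∞} {c : ℝ≥0∞}
    (h : ∀ a, p a ≠ 0 → f a ≤ c) : ∑' a, p a * f a ≤ c := by
  rw [← tsum_pmf_mul_const p c]
  refine ENNReal.tsum_le_tsum fun a => ?_
  rcases eq_or_ne (p a) 0 with ha | ha
  · simp [ha]
  · gcongr
    exact h a ha

lemma le_tsum_pmf_mul {α : Type*} (p : PMF α) {f : α → ℝ≥0∞} {c : ℝ≥0∞}
    (h : ∀ a, p a ≠ 0 → c ≤ f a) : c ≤ ∑' a, p a * f a := by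
  rw [← tsum_pmf_mul_const p c]
  refine ENNReal.tsum_le_tsum fun a => ?_
  rcases eq_or_ne (p a) 0 with ha | ha
  · simp [ha]
  · gcongr
    exact h a ha

/-! ### Moves and the one-step operator -/

lemma legalMoves_nonempty (i : Token) (s : State V) : (legalMoves G i s).Nonempty := by
  rcases s with ⟨x₁, x₂, x₃, u⟩ | _
  · cases u <;> cases i <;> simp [legalMoves, closedNbhd, Set.Nonempty]
  · cases i <;> simp [legalMoves]

instance (i : Token) (s : State V) : Nonempty (legalMoves G i s) :=
  (legalMoves_nonempty i s).to_subtype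

/-- The one-step operator of value iteration, in a form that is uniform in the state. -/
noncomputable def gameOp (σ₃ : Strategy G .R) (w : State V → ℝ≥0∞) (s : State V) : ℝ≥0∞ :=
  ⨆ a₁ : legalMoves G .C₁ s, ⨅ a₂ : legalMoves G .C₂ s, lookahead σ₃ w s a₁ a₂

/-- One of the two sets of legal moves is always a singleton, so one of the two extrema is trivial.
-/
lemma gameOp_eq_iInf_iSup (σ₃ : Strategy G .R) (w : State V → ℝ≥0∞) (s : State V) :
    gameOp σ₃ w s =
      ⨅ a₂ : legalMoves G .C₂ s, ⨆ a₁ : legalMoves G .C₁ s, lookahead σ₃ w s a₁ a₂ := by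
  simp only [gameOp, iSup_subtype, iInf_subtype]
  rcases s with ⟨x₁, x₂, x₃, u⟩ | _
  · cases u <;> simp only [legalMoves, Set.mem_singleton_iff, iInf_iInf_eq_left,
      iSup_iSup_eq_left]
  · simp only [legalMoves, Set.mem_singleton_iff, iInf_iInf_eq_left, iSup_iSup_eq_left]

lemma transLaw_of_capture (σ₃ : Strategy G .R) {s : State V} (hs : IsCapture s)
    (a₁ a₂ : Move V) : transLaw σ₃ s a₁ a₂ = PMF.pure .terminal := by
  rcases s with ⟨x₁, x₂, x₃, u⟩ | _
  · simp only [transLaw, next, if_pos hs]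
    exact PMF.map_const _ _
  · exact PMF.map_const _ _

lemma lookahead_terminal (σ₃ : Strategy G .R) (w : State V → ℝ≥0∞) (a₁ a₂ : Move V) :
    lookahead σ₃ w .terminal a₁ a₂ = w .terminal := by
  have h : transLaw σ₃ .terminal a₁ a₂ = PMF.pure .terminal := PMF.map_const _ _
  rw [lookahead, h, tsum_eq_single .terminal fun s hs => by simp [hs]]
  simp [q, IsCapture₁]

lemma gameOp_terminal (σ₃ : Strategy G .R) (w : State V → ℝ≥0∞) :
    gameOp σ₃ w .terminal = w .terminal := by
  simp [gameOp, lookahead_terminal]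

lemma lookahead_mono (σ₃ : Strategy G .R) (s : State V) (a₁ a₂ : Move V) :
    Monotone fun w => lookahead σ₃ w s a₁ a₂ := fun w w' h => by
  exact add_le_add_right (ENNReal.tsum_le_tsum fun s' => mul_le_mul_right (h s') _) _

lemma gameOp_mono (σ₃ : Strategy G .R) : Monotone (gameOp σ₃) := fun _ _ h s =>
  iSup_mono fun _ => iInf_mono fun _ => lookahead_mono σ₃ s _ _ h

/-- The immediate payoff and the continuation are never both positive: `q` is nonzero only in
capture states, whose successor is terminal. -/
lemma lookahead_le_one (σ₃ : Strategy G .R) {w : State V → ℝ≥0∞} (hw : ∀ s, w s ≤ 1)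
    (hτ : w .terminal = 0) (s : State V) (a₁ a₂ : Move V) : lookahead σ₃ w s a₁ a₂ ≤ 1 := by
  by_cases hs : IsCapture s
  · rw [lookahead, transLaw_of_capture σ₃ hs, tsum_eq_single .terminal fun s hs => by simp [hs],
      hτ, mul_zero, add_zero, q]
    split_ifs <;> simp
  · have : q s = 0 := if_neg fun h => hs (Or.inl h)
    rw [lookahead, this, zero_add]
    exact tsum_pmf_mul_le _ fun a _ => hw a

/-! ### Value iteration -/

lemma valueIter_terminal (σ₃ : Strategy G .R) (i : ℕ) : valueIter σ₃ i .terminal = 0 := by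
  cases i <;> rfl

lemma valueIter_zero (σ₃ : Strategy G .R) : valueIter σ₃ 0 = q := by
  funext s
  rcases s with ⟨x₁, x₂, x₃, u⟩ | _
  · cases u <;> rfl
  · simp [valueIter_terminal, q, IsCapture₁]

lemma valueIter_succ (σ₃ : Strategy G .R) (i : ℕ) :
    valueIter σ₃ (i + 1) = gameOp σ₃ (valueIter σ₃ i) := by
  funext s
  rcases s with ⟨x₁, x₂, x₃, u⟩ | _
  · simp only [gameOp, iSup_subtype, iInf_subtype]
    cases u
    · have h : legalMoves G .C₂ (.pos x₁ x₂ x₃ .C₁) = {some x₂} := rfl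
      simp only [h, Set.mem_singleton_iff, iInf_iInf_eq_left, valueIter]
    · have h : legalMoves G .C₁ (.pos x₁ x₂ x₃ .C₂) = {some x₁} := rfl
      simp only [h, Set.mem_singleton_iff, iSup_iSup_eq_left, valueIter]
  · rw [gameOp_terminal, valueIter_terminal, valueIter_terminal]

lemma q_le_gameOp (σ₃ : Strategy G .R) (w : State V → ℝ≥0∞) : q ≤ gameOp σ₃ w := fun _ =>
  le_iSup_of_le (Classical.arbitrary _) (le_iInf fun _ => le_self_add)

lemma valueIter_mono (σ₃ : Strategy G .R) : Monotone (valueIter σ₃) := by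
  refine monotone_nat_of_le_succ fun i => ?_
  induction i with
  | zero => rw [valueIter_zero, valueIter_succ]; exact q_le_gameOp σ₃ _
  | succ i ih =>
    rw [valueIter_succ, valueIter_succ σ₃ (i + 1)]
    exact gameOp_mono σ₃ ih

lemma valueIter_le_one (σ₃ : Strategy G .R) (i : ℕ) (s : State V) : valueIter σ₃ i s ≤ 1 := by
  induction i generalizing s with
  | zero => rw [valueIter_zero, q]; split_ifs <;> simp
  | succ i ih =>
    rw [valueIter_succ]
    exact iSup_le fun _ => iInf_le_of_le (Classical.arbitrary _)
      (lookahead_le_one σ₃ ih (valueIter_terminal σ₃ i) s _ _)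

/-- The limit of value iteration. -/
noncomputable def valueLim (σ₃ : Strategy G .R) (s : State V) : ℝ≥0∞ := ⨆ i, valueIter σ₃ i s

lemma valueLim_le_one (σ₃ : Strategy G .R) (s : State V) : valueLim σ₃ s ≤ 1 :=
  iSup_le fun i => valueIter_le_one σ₃ i s

lemma lookahead_iSup (σ₃ : Strategy G .R) {w : ℕ → State V → ℝ≥0∞} (hw : Monotone w)
    (s : State V) (a₁ a₂ : Move V) :
    lookahead σ₃ (fun s => ⨆ i, w i s) s a₁ a₂ = ⨆ i, lookahead σ₃ (w i) s a₁ a₂ := by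
  simp only [lookahead, ← ENNReal.add_iSup, ENNReal.mul_iSup]
  congr 1
  -- The sum becomes an integral against counting measure, so that monotone convergence applies.
  simp_rw [← lintegral_count (α := State V)]
  exact lintegral_iSup (fun _ => .of_discrete) fun _ _ h s' => mul_le_mul_right (hw h s') _

/-! ### Strategies and the conditional law of the next state -/

/-- Independence of the moves factors the average. Stationarity of `σ₃` replaces the full history by
its last state, which is what ties arbitrary play to `lookahead`. -/
lemma tsum_stepLaw_mul (σ₁ : Strategy G .C₁) (σ₂ : Strategy G .C₂) {σ₃ : Strategy G .R}
    (hσ₃ : σ₃.IsStationaryMarkovian) (t : ℕ) (h : History V t) (w : State V → ℝ≥0∞) :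
    q h.last + ∑' s, stepLaw σ₁ σ₂ σ₃ t h s * w s =
      ∑' a₁, σ₁.prob t h a₁ * ∑' a₂, σ₂.prob t h a₂ * lookahead σ₃ w h.last a₁ a₂ := by
  have h₃ : σ₃.prob t h = σ₃.prob 0 (fun _ => h.last) := hσ₃ _ _ _ _ rfl
  simp only [lookahead, mul_add, ENNReal.tsum_add, tsum_pmf_mul_const]
  simp only [stepLaw, h₃, tsum_bind_mul]
  rfl

/-- The deterministic strategy that plays `d t s` in state `s` at time `t`. -/
noncomputable def pureStrategy (i : Token) (d : ℕ → State V → Move V)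
    (hd : ∀ t s, d t s ∈ legalMoves G i s) : Strategy G i where
  prob t h := PMF.pure (d t h.last)
  legal t h a ha := by
    rw [PMF.pure_apply, if_neg]
    rintro rfl
    exact ha (hd _ _)

/-! ### Optimal moves -/

variable [Finite V]

lemma gameOp_valueLim (σ₃ : Strategy G .R) : gameOp σ₃ (valueLim σ₃) = valueLim σ₃ := by
  funext s
  have h : ∀ a₁ a₂, lookahead σ₃ (valueLim σ₃) s a₁ a₂ =
      ⨆ i, lookahead σ₃ (valueIter σ₃ i) s a₁ a₂ :=
    fun a₁ a₂ => lookahead_iSup σ₃ (valueIter_mono σ₃) s a₁ a₂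
  have hm : ∀ a₁ a₂, Monotone fun i => lookahead σ₃ (valueIter σ₃ i) s a₁ a₂ :=
    fun a₁ a₂ => (lookahead_mono σ₃ s a₁ a₂).comp (valueIter_mono σ₃)
  have hs : valueLim σ₃ s = ⨆ i, valueIter σ₃ (i + 1) s :=
    (Monotone.iSup_nat_add (f := fun i => valueIter σ₃ i s)
      (fun i j hij => valueIter_mono σ₃ hij s) 1).symm
  simp only [hs, valueIter_succ]
  simp only [gameOp, h]
  rw [iSup_comm]
  -- Exchanging the infimum with an increasing supremum needs the set of moves of `C₂` to be finite.
  exact iSup_congr fun a₁ => (iSup_iInf_of_monotone fun a₂ => hm _ _).symm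

lemma exists_move₁ (σ₃ : Strategy G .R) (w : State V → ℝ≥0∞) (s : State V) :
    ∃ a₁ ∈ legalMoves G .C₁ s, ∀ a₂ ∈ legalMoves G .C₂ s,
      gameOp σ₃ w s ≤ lookahead σ₃ w s a₁ a₂ := by
  obtain ⟨a₁, h⟩ := exists_eq_ciSup_of_finite
    (f := fun a₁ : legalMoves G .C₁ s => ⨅ a₂ : legalMoves G .C₂ s, lookahead σ₃ w s a₁ a₂)
  exact ⟨a₁, a₁.2, fun a₂ h₂ => h.symm.le.trans (iInf_le_of_le ⟨a₂, h₂⟩ le_rfl)⟩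

lemma exists_move₂ (σ₃ : Strategy G .R) (w : State V → ℝ≥0∞) (s : State V) :
    ∃ a₂ ∈ legalMoves G .C₂ s, ∀ a₁ ∈ legalMoves G .C₁ s,
      lookahead σ₃ w s a₁ a₂ ≤ gameOp σ₃ w s := by
  obtain ⟨a₂, h⟩ := exists_eq_ciInf_of_finite
    (f := fun a₂ : legalMoves G .C₂ s => ⨆ a₁ : legalMoves G .C₁ s, lookahead σ₃ w s a₁ a₂)
  rw [gameOp_eq_iInf_iSup, ← h]
  exact ⟨a₂, a₂.2, fun a₁ h₁ =>
    le_iSup (fun a₁ : legalMoves G .C₁ s => lookahead σ₃ w s a₁ a₂) ⟨a₁, h₁⟩⟩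

/-! ### Expected payoffs along the play -/

/-- The expectation of `f (s_t)`. -/
noncomputable def expect (σ₃ : Strategy G .R) (σ₁ : Strategy G .C₁) (σ₂ : Strategy G .C₂)
    (s₀ : State V) (t : ℕ) (f : State V → ℝ≥0∞) : ℝ≥0∞ :=
  ∫⁻ ω, f (ω t) ∂(playMeasure σ₁ σ₂ σ₃ s₀)

section

variable (σ₃ : Strategy G .R) (σ₁ : Strategy G .C₁) (σ₂ : Strategy G .C₂) (s₀ : State V)

lemma J_eq_tsum_expect : J σ₃ σ₁ σ₂ s₀ = ∑' t, expect σ₃ σ₁ σ₂ s₀ t q :=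
  lintegral_tsum fun t =>
    ((Measurable.of_discrete (f := q)).comp (measurable_pi_apply t)).aemeasurable

lemma expect_eq_lintegral_partialTraj (t : ℕ) (f : State V → ℝ≥0∞) :
    expect σ₃ σ₁ σ₂ s₀ t f = ∫⁻ h : History V t, f h.last
      ∂(Kernel.partialTraj (X := fun _ => State V) (stepKernel σ₁ σ₂ σ₃) 0 t (fun _ => s₀)) := by
  rw [← Kernel.traj_map_frestrictLe_apply, lintegral_map .of_discrete (by fun_prop)]
  rfl

lemma expect_zero (f : State V → ℝ≥0∞) : expect σ₃ σ₁ σ₂ s₀ 0 f = f s₀ := by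
  rw [expect_eq_lintegral_partialTraj, Kernel.partialTraj_self, Kernel.id_apply,
    lintegral_dirac]
  rfl

/-- Condition on the history up to time `t`: the continued trajectory has its next state distributed
by `stepLaw`. -/
lemma expect_succ (t : ℕ) (f : State V → ℝ≥0∞) :
    expect σ₃ σ₁ σ₂ s₀ (t + 1) f =
      ∫⁻ h : History V t, ∑' s, stepLaw σ₁ σ₂ σ₃ t h s * f s
        ∂(Kernel.partialTraj (X := fun _ => State V) (stepKernel σ₁ σ₂ σ₃) 0 t
          (fun _ => s₀)) := by
  have hf : Measurable fun ω : ℕ → State V => f (ω (t + 1)) :=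
    (Measurable.of_discrete (f := f)).comp (measurable_pi_apply (t + 1))
  rw [expect, playMeasure, ← Kernel.traj_comp_partialTraj (Nat.zero_le t),
    Kernel.lintegral_comp _ _ _ hf]
  refine lintegral_congr fun h => ?_
  have h₁ : (Kernel.traj (X := fun _ => State V) (stepKernel σ₁ σ₂ σ₃) t h).map
      (fun ω => ω (t + 1)) = (stepLaw σ₁ σ₂ σ₃ t h).toMeasure := by
    rw [← Kernel.map_apply _ (by fun_prop), Kernel.map_traj_succ_self]
    rfl
  rw [← lintegral_map (f := f) (g := fun ω : ℕ → State V => ω (t + 1)) .of_discrete (by fun_prop),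
    h₁, lintegral_countable']
  refine tsum_congr fun s => ?_
  rw [PMF.toMeasure_apply_singleton _ _ (measurableSet_singleton s), mul_comm]

lemma expect_q_add_expect_succ (t : ℕ) (f : State V → ℝ≥0∞) :
    expect σ₃ σ₁ σ₂ s₀ t q + expect σ₃ σ₁ σ₂ s₀ (t + 1) f =
      ∫⁻ h : History V t, q h.last + ∑' s, stepLaw σ₁ σ₂ σ₃ t h s * f s
        ∂(Kernel.partialTraj (X := fun _ => State V) (stepKernel σ₁ σ₂ σ₃) 0 t
          (fun _ => s₀)) := by
  rw [expect_succ, expect_eq_lintegral_partialTraj, lintegral_add_left .of_discrete]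

end

/-- `C₁` secures the `n`-th iterate of value iteration by playing optimally for `n` turns. -/
lemma exists_valueIter_le_J {σ₃ : Strategy G .R} (hσ₃ : σ₃.IsStationaryMarkovian) (n : ℕ) :
    ∃ σ₁ : Strategy G .C₁, ∀ (σ₂ : Strategy G .C₂) (s₀ : State V),
      valueIter σ₃ n s₀ ≤ J σ₃ σ₁ σ₂ s₀ := by
  -- After the move at time `t`, `n - (t + 1)` turns of the horizon remain. For `t ≥ n` the
  -- subtraction truncates to 0 and the choice is irrelevant.
  choose d hd hopt using fun (t : ℕ) (s : State V) =>
    exists_move₁ σ₃ (valueIter σ₃ (n - (t + 1))) s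
  refine ⟨pureStrategy .C₁ d hd, fun σ₂ s₀ => ?_⟩
  set σ₁ := pureStrategy .C₁ d hd with hσ₁
  have step : ∀ t < n, expect σ₃ σ₁ σ₂ s₀ t (valueIter σ₃ (n - t)) ≤
      expect σ₃ σ₁ σ₂ s₀ t q + expect σ₃ σ₁ σ₂ s₀ (t + 1) (valueIter σ₃ (n - (t + 1))) := by
    intro t ht
    rw [expect_q_add_expect_succ, expect_eq_lintegral_partialTraj]
    refine lintegral_mono fun (h : History V t) => ?_
    rw [tsum_stepLaw_mul σ₁ σ₂ hσ₃]
    refine le_tsum_pmf_mul _ fun a₁ ha₁ => le_tsum_pmf_mul _ fun a₂ ha₂ => ?_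
    have e₁ : a₁ = d t h.last := by
      by_contra hne
      exact ha₁ (by simp [hσ₁, pureStrategy, hne])
    have h₂ : a₂ ∈ legalMoves G .C₂ h.last := by
      by_contra hne
      exact ha₂ (σ₂.legal t h a₂ hne)
    rw [e₁, show n - t = n - (t + 1) + 1 by omega, valueIter_succ]
    exact hopt t h.last a₂ h₂
  have key : ∀ t ≤ n, valueIter σ₃ n s₀ ≤ ∑ k ∈ Finset.range t, expect σ₃ σ₁ σ₂ s₀ k q +
      expect σ₃ σ₁ σ₂ s₀ t (valueIter σ₃ (n - t)) := by
    intro t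
    induction t with
    | zero => intro _; simp [expect_zero]
    | succ t ih =>
      intro ht
      rw [Finset.sum_range_succ, add_assoc]
      exact (ih (by omega)).trans (add_le_add_right (step t (by omega)) _)
  have hn := key n le_rfl
  -- The leftover term is the expectation of `q` at time `n`, which completes a partial sum of `J`.
  rw [Nat.sub_self, valueIter_zero, ← Finset.sum_range_succ] at hn
  rw [J_eq_tsum_expect]
  exact hn.trans (ENNReal.sum_le_tsum _)

/-- `C₂` keeps the payoff below the limit of value iteration by a stationary strategy. -/
lemma exists_J_le_valueLim {σ₃ : Strategy G .R} (hσ₃ : σ₃.IsStationaryMarkovian) :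
    ∃ σ₂ : Strategy G .C₂, ∀ (σ₁ : Strategy G .C₁) (s₀ : State V),
      J σ₃ σ₁ σ₂ s₀ ≤ valueLim σ₃ s₀ := by
  choose d hd hopt using fun s : State V => exists_move₂ σ₃ (valueLim σ₃) s
  refine ⟨pureStrategy .C₂ (fun _ => d) fun _ => hd, fun σ₁ s₀ => ?_⟩
  set σ₂ := pureStrategy .C₂ (fun _ => d) fun _ => hd with hσ₂
  have step : ∀ t, expect σ₃ σ₁ σ₂ s₀ t q + expect σ₃ σ₁ σ₂ s₀ (t + 1) (valueLim σ₃) ≤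
      expect σ₃ σ₁ σ₂ s₀ t (valueLim σ₃) := by
    intro t
    rw [expect_q_add_expect_succ, expect_eq_lintegral_partialTraj]
    refine lintegral_mono fun (h : History V t) => ?_
    rw [tsum_stepLaw_mul σ₁ σ₂ hσ₃]
    refine tsum_pmf_mul_le _ fun a₁ ha₁ => tsum_pmf_mul_le _ fun a₂ ha₂ => ?_
    have e₂ : a₂ = d h.last := by
      by_contra hne
      exact ha₂ (by simp [hσ₂, pureStrategy, hne])
    have h₁ : a₁ ∈ legalMoves G .C₁ h.last := by
      by_contra hne
      exact ha₁ (σ₁.legal t h a₁ hne)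
    rw [e₂]
    exact (hopt h.last a₁ h₁).trans_eq (congrFun (gameOp_valueLim σ₃) _)
  have key : ∀ t, ∑ k ∈ Finset.range t, expect σ₃ σ₁ σ₂ s₀ k q +
      expect σ₃ σ₁ σ₂ s₀ t (valueLim σ₃) ≤ valueLim σ₃ s₀ := by
    intro t
    induction t with
    | zero => simp [expect_zero]
    | succ t ih =>
      rw [Finset.sum_range_succ, add_assoc]
      exact (add_le_add_right (step t) _).trans ih
  rw [J_eq_tsum_expect, ENNReal.tsum_eq_iSup_nat]
  -- The nonnegative remainder is dropped, so it need not tend to zero.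
  exact iSup_le fun t => le_self_add.trans (key t)

lemma isValue_valueLim {σ₃ : Strategy G .R} (hσ₃ : σ₃.IsStationaryMarkovian) (s₀ : State V) :
    IsValue σ₃ s₀ (valueLim σ₃ s₀) := by
  have lower : valueLim σ₃ s₀ ≤
      ⨆ σ₁ : Strategy G .C₁, ⨅ σ₂ : Strategy G .C₂, J σ₃ σ₁ σ₂ s₀ := by
    refine iSup_le fun n => ?_
    obtain ⟨σ₁, h⟩ := exists_valueIter_le_J hσ₃ n
    exact le_iSup_of_le σ₁ (le_iInf fun σ₂ => h σ₂ s₀)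
  have upper : (⨅ σ₂ : Strategy G .C₂, ⨆ σ₁ : Strategy G .C₁, J σ₃ σ₁ σ₂ s₀) ≤
      valueLim σ₃ s₀ := by
    obtain ⟨σ₂, h⟩ := exists_J_le_valueLim hσ₃
    exact iInf_le_of_le σ₂ (iSup_le fun σ₁ => h σ₁ s₀)
  have minimax := iSup_iInf_le_iInf_iSup
    fun (σ₁ : Strategy G .C₁) (σ₂ : Strategy G .C₂) => J σ₃ σ₁ σ₂ s₀
  exact ⟨(minimax.trans upper).antisymm lower, upper.antisymm (lower.trans minimax)⟩

end SCPR

theorem mainTheorem4 {V : Type*} [Fintype V] (G : SimpleGraph V) (hG : G.Connected)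
    (σ₃ : SCPR.Strategy G .R) (hσ₃ : σ₃.IsStationaryMarkovian)
    (x₁ x₂ x₃ : V) (u : SCPR.Cop) :
    ∃ v : ℝ≥0, SCPR.IsValue σ₃ (.pos x₁ x₂ x₃ u) (v : ℝ≥0∞) ∧
      Tendsto (fun i : ℕ => SCPR.valueIter σ₃ i (.pos x₁ x₂ x₃ u)) atTop (𝓝 (v : ℝ≥0∞)) := by
  set s : SCPR.State V := .pos x₁ x₂ x₃ u
  have hv : ((SCPR.valueLim σ₃ s).toNNReal : ℝ≥0∞) = SCPR.valueLim σ₃ s :=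
    ENNReal.coe_toNNReal ((SCPR.valueLim_le_one σ₃ s).trans_lt ENNReal.one_lt_top).ne
  refine ⟨(SCPR.valueLim σ₃ s).toNNReal, ?_, ?_⟩ <;> rw [hv]
  · exact SCPR.isValue_valueLim hσ₃ s
  · exact tendsto_atTop_iSup fun i j hij => SCPR.valueIter_mono σ₃ hij s
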